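/- Let $(R,\mathfrak m)$ be a Noetherian local ring with infinite residue field $k=R/\mathfrak m$ and let $I$ be an ideal of $R$. Let $x_1,\dots,x_s,y$ be a minimal generating set of $I$, where $J=(x_1,\dots,x_s)$ is a reduction of $I$ with reduction number $r=\mathrm r_J(I)$, i.e. $r$ is the least integer $r\ge 0$ such that $I^{r+1}=JI^{r}$. Assume that $x_1,\dots,x_s$ is an $R$-regular sequence and that the initial forms $x_1^*,\dots,x_{s-1}^*$ form a regular sequence in the associated graded ring $\mathbf G(I)=\bigoplus_{n\ge 0}I^n/I^{n+1}$. Let $\mathbf R(I)=R[It]=\bigoplus_{n\ge0} I^n$ be the Rees algebra of $I$ and $\mathbf F(I)=\mathbf R(I)\otimes_R R/\mathfrak m=\bigoplus_{n\ge 0}I^n/\mathfrak m I^n$ the fiber cone of $I$. Then there are forms $F_1,\dots,F_s\in k[X_1,\dots,X_s,Y]$ of degree $r$ (possibly zero) such that sending $X_i$ and $Y$ to the classes of $x_i$ and $y$ in $I/\mathfrak m I$ induces an isomorphism of $k$-algebras $$k[X_1,\dots,X_s,Y]\Big/\Big(Y^{r+1}-\sum_{i=1}^s X_iF_i\Big)\;\cong\;\mathbf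 F(I).$$ In particular, $\mathrm{rt}(\mathbf F(I))=r+1=\mathrm{rt}(I)$. Here, for an algebra $U=\bigoplus_{n\ge0}U_n$ over $A=U_0$ with polynomial presentation $A[T_1,\dots,T_m]\to U$ sending the variables to a minimal generating set of $U_1$, with kernel $Q$, the relation type $\mathrm{rt}(U)$ is the least integer $N\ge1$ such that $Q$ is generated by its homogeneous elements of degree at most $N$. It is taken for $\mathbf F(I)$ over $k$ with respect to the classes of $x_1,\dots,x_s,y$ in $I/\mathfrak m I$, and $\mathrm{rt}(I)$ is the relation type of $\mathbf R(I)$ over $R$ with respect to $x_1t,\dots,x_st,yt$. -/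

import Mathlib

open scoped TensorProduct

noncomputable section

namespace BlowupAlgebra

open IsLocalRing

section Ideals

variable {R : Type*} [CommRing R]

/-- The family `z` is a minimal generating set of the ideal `I`: it generates `I`, and no member
of the family lies in the ideal generated by the others. -/
structure IsMinimalGeneratingFamily {σ : Type*} (I : Ideal R) (z : σ → R) : Prop where
  span_eq : Ideal.span (Set.range z) = I
  not_mem_span : ∀ i, z i ∉ Ideal.span (z '' {j | j ≠ i})

theorem IsMinimalGeneratingFamily.mem {σ : Type*} {I : Ideal R} {z : σ → R}
    (h : IsMinimalGeneratingFamily I z) (i : σ) : z i ∈ I :=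
  h.span_eq ▸ Ideal.subset_span (Set.mem_range_self i)

/-- The family `x₁, …, xₛ, y`, indexed by `Option (Fin s)`: the index `some i` carries `xᵢ` and
the index `none` carries `y`. -/
def adjoinElt {s : ℕ} (x : Fin s → R) (y : R) : Option (Fin s) → R :=
  fun o => o.elim y x

/-- `J` is a reduction of `I`: `J ⊆ I` and `I ^ (n + 1) = J * I ^ n` for some `n`. -/
def IsReduction (J I : Ideal R) : Prop :=
  J ≤ I ∧ ∃ n : ℕ, I ^ (n + 1) = J * I ^ n

/-- The reduction number `r_J(I)`: the least `n ≥ 0` such that `I ^ (n + 1) = J * I ^ n`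
(meaningful when `J` is a reduction of `I`). -/
def reductionNumber (J I : Ideal R) : ℕ :=
  sInf {n : ℕ | I ^ (n + 1) = J * I ^ n}

/-- The element `a tⁿ` of the Rees algebra `R[It] = ⨁ Iⁿ tⁿ`, for `a ∈ Iⁿ`. -/
def reesMonomial (I : Ideal R) (n : ℕ) (a : R) (ha : a ∈ I ^ n) : reesAlgebra I :=
  ⟨Polynomial.monomial n a, reesAlgebra.monomial_mem.mpr ha⟩

/-- The associated graded ring `G(I) = ⨁ Iⁿ / Iⁿ⁺¹`, as the quotient of the Rees algebra
`R[It] = ⨁ Iⁿ tⁿ` by its ideal `I · R[It] = ⨁ Iⁿ⁺¹ tⁿ`. -/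
abbrev AssociatedGraded (I : Ideal R) : Type _ :=
  reesAlgebra I ⧸ I.map (algebraMap R (reesAlgebra I))

open Classical in
/-- The initial form `a*` of `a` in `G(I)`: the class of `a` in `Iⁿ / Iⁿ⁺¹` if `a ∈ Iⁿ` and
`a ∉ Iⁿ⁺¹` (there is at most one such `n`), and `0` if `a` lies in all powers of `I`. -/
def initialForm (I : Ideal R) (a : R) : AssociatedGraded I :=
  if h : ∃ n : ℕ, a ∈ I ^ n ∧ a ∉ I ^ (n + 1) then
    Ideal.Quotient.mk _ (reesMonomial I h.choose a h.choose_spec.1)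
  else 0

/-- The family of elements `zᵢ t`, of degree one in the Rees algebra `R[It]`. -/
def reesGenerators {σ : Type*} (I : Ideal R) (z : σ → R) (hz : ∀ i, z i ∈ I) :
    σ → reesAlgebra I :=
  fun i => reesMonomial I 1 (z i) (by simpa using hz i)

end Ideals

section RelationType

variable (A : Type*) {U σ : Type*} [CommRing A] [CommRing U] [Algebra A U]

/-- The ideal `Q` of equations of `U`: the kernel of the polynomial presentation
`A[T] → U`, `Tᵢ ↦ zᵢ`. -/
def equations (z : σ → U) : Ideal (MvPolynomial σ A) :=
  RingHom.ker (MvPolynomial.aeval (R := A) z)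

/-- The ideal `Q⟨n⟩` generated by the homogeneous equations of degree at most `n`. -/
def equationsUpTo (z : σ → U) (n : ℕ) : Ideal (MvPolynomial σ A) :=
  Ideal.span {F | F ∈ equations A z ∧ ∃ d ≤ n, F.IsHomogeneous d}

/-- The relation type of the standard `A`-algebra `U` presented by the generators `z` of degree
one: the least integer `N ≥ 1` such that `Q = Q⟨N⟩`. (The value is `0` exactly when there is no
such `N`.) -/
def relationType (z : σ → U) : ℕ :=
  sInf {N : ℕ | 1 ≤ N ∧ equations A z = equationsUpTo A z N}

end RelationType

section FiberCone

variable {R : Type*} [CommRing R] [IsLocalRing R]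

/-- The fiber cone `F(I) = R/𝔪 ⊗ R[It] = ⨁ Iⁿ / 𝔪 Iⁿ`, an algebra over the residue field. -/
abbrev FiberCone (I : Ideal R) : Type _ :=
  ResidueField R ⊗[R] reesAlgebra I

/-- The classes in `I / 𝔪 I ⊆ F(I)` of the elements `zᵢ` of `I`. -/
def fiberGenerators {σ : Type*} (I : Ideal R) (z : σ → R) (hz : ∀ i, z i ∈ I) :
    σ → FiberCone I :=
  fun i => 1 ⊗ₜ[R] reesGenerators I z hz i

end FiberCone

end BlowupAlgebra

end

/-! Write z = (x₁, …, xₛ, y). Since y ^ (r + 1) ∈ J * I ^ r, there is an equation P = Y ^ (r + 1) -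
∑ Xᵢ Fᵢ of the Rees algebra. Two facts give the theorem: every equation of the Rees algebra lies in
the ideal generated by P and the equations of degree at most r, and every equation of degree at most
r has all its coefficients in 𝔪. Reduction modulo 𝔪 then leaves P alone.

The first fact (`mem_span_sup_equationsUpTo`) is about syzygies. Regularity of x, together with that
of all but the last initial form, makes each xᵢ a nonzerodivisor modulo any of the others,
compatibly with the I-adic filtration (Valabrega–Valla and a permutation argument). In degree above
r, subtracting a multiple of P leaves ∑ Xᵢ Gᵢ, and Koszul relations turn the Gᵢ into equations of
one degree less.

The second fact (`map_residue_eq_zero_of_eval_eq_zero`) uses the infinite residue field. If an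
equation p of degree at most r survived modulo 𝔪, a general point c with p(c, 1) a unit would give I
^ r ⊆ J' * I ^ (r - 1) for J' = (xᵢ - cᵢ y). Replacing one generator at a time carries this
inclusion from J' back to J, against the minimality of r. -/

namespace BlowupAlgebra

open IsLocalRing

/-! ### Filtered regular sequences and their permutability -/

section RegularModulo

variable {R : Type*} [CommRing R]

/-- `a` is a nonzerodivisor on the extended Rees module of `I` modulo `K`, in all degrees
`d + 1 ≥ 1`; the truncated subtraction encodes the convention `I⁻¹ = R`. -/
def RegularModulo (I K : Ideal R) (a : R) : Prop :=
  ∀ d : ℕ, ∀ g ∈ I ^ d, a * g ∈ K * I ^ d → g ∈ K * I ^ (d - 1)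

theorem mul_mem_mul_pow_of_mem_pow_pred {I K : Ideal R} {a u : R} {d : ℕ} (ha : a ∈ I)
    (hu : u ∈ K * I ^ (d - 1)) : a * u ∈ K * I ^ d := by
  cases d with
  | zero => exact Ideal.mul_mem_left _ _ hu
  | succ d =>
    have := Ideal.mul_mem_mul ha hu
    rwa [mul_left_comm, Nat.add_sub_cancel, ← pow_succ'] at this

theorem mul_mem_pow_of_mem_pow_pred {I : Ideal R} {a u : R} {d : ℕ} (ha : a ∈ I)
    (hu : u ∈ I ^ (d - 1)) : a * u ∈ I ^ d := by
  have := mul_mem_mul_pow_of_mem_pow_pred (K := ⊤) ha (by simpa using hu)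
  simpa using this

theorem exists_add_mul_of_mem_sup_span_mul {K L : Ideal R} {a u : R}
    (h : u ∈ (K ⊔ Ideal.span {a}) * L) : ∃ k ∈ K * L, ∃ v ∈ L, u = k + a * v := by
  rw [Ideal.sup_mul] at h
  obtain ⟨k, hk, w, hw, rfl⟩ := Submodule.mem_sup.mp h
  obtain ⟨v, hv, rfl⟩ := Ideal.mem_span_singleton_mul.mp hw
  exact ⟨k, hk, v, hv, rfl⟩

theorem add_mul_mem_sup_span_mul {K L : Ideal R} {a k v : R} (hk : k ∈ K * L) (hv : v ∈ L) :
    k + a * v ∈ (K ⊔ Ideal.span {a}) * L := by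
  rw [Ideal.sup_mul]
  exact Submodule.add_mem_sup hk (Ideal.mul_mem_mul (Ideal.mem_span_singleton_self a) hv)

theorem mem_of_forall_mem_sup_pow [IsLocalRing R] [IsNoetherianRing R] {L : Ideal R} {a g : R}
    (ha : a ∈ maximalIdeal R) (h : ∀ N : ℕ, g ∈ L ⊔ Ideal.span {a ^ N}) : g ∈ L := by
  have key := Ideal.iInf_pow_smul_eq_bot_of_isLocalRing (M := R ⧸ L) (maximalIdeal R)
    (IsLocalRing.maximalIdeal.isMaximal R).ne_top
  rw [← Ideal.Quotient.eq_zero_iff_mem, ← Submodule.mem_bot (R := R), ← key, Submodule.mem_iInf]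
  intro N
  obtain ⟨l, hl, w, hw, rfl⟩ := Submodule.mem_sup.mp (h N)
  obtain ⟨v, rfl⟩ := Ideal.mem_span_singleton'.mp hw
  have h1 : (Ideal.Quotient.mk L) (l + v * a ^ N) = a ^ N • Ideal.Quotient.mk L v := by
    rw [map_add, Ideal.Quotient.eq_zero_iff_mem.mpr hl, zero_add, mul_comm, map_mul]
    rfl
  rw [h1]
  exact Submodule.smul_mem_smul (Ideal.pow_mem_pow ha N) trivial

/-- The usual argument for permuting regular sequences in a local ring: an element g killed by b
modulo K has the form k + a * v with v again killed by b. Iterating puts g in every K * I ^ (d - 1)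
+ (a ^ N), and Krull's intersection theorem finishes. -/
theorem RegularModulo.of_sup [IsLocalRing R] [IsNoetherianRing R] {I K : Ideal R} {a b : R}
    (hI : I ≤ maximalIdeal R) (ha : a ∈ I) (hb : b ∈ I)
    (hab : RegularModulo I (K ⊔ Ideal.span {a}) b) (hKa : RegularModulo I K a) :
    RegularModulo I K b := by
  have key : ∀ N d : ℕ, ∀ g ∈ I ^ d, b * g ∈ K * I ^ d →
      g ∈ K * I ^ (d - 1) ⊔ Ideal.span {a ^ N} := by
    intro N
    induction N with
    | zero => intro d g _ _; simp
    | succ N ih =>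
      intro d g hg hbg
      obtain ⟨k, hk, v, hv, rfl⟩ := exists_add_mul_of_mem_sup_span_mul
        (hab d g hg (Ideal.mul_mono_left le_sup_left hbg))
      have h1 : a * (b * v) ∈ K * I ^ d := by
        have h2 := sub_mem hbg (mul_mem_mul_pow_of_mem_pow_pred hb hk)
        rwa [show b * (k + a * v) - b * k = a * (b * v) by ring] at h2
      obtain ⟨l, hl, w, hw, hlw⟩ := Submodule.mem_sup.mp
        (ih (d - 1) v hv (hKa d _ (mul_mem_pow_of_mem_pow_pred hb hv) h1))
      obtain ⟨c, rfl⟩ := Ideal.mem_span_singleton'.mp hw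
      rw [← hlw, show k + a * (l + c * a ^ N) = (k + a * l) + c * a ^ (N + 1) by ring]
      exact Submodule.add_mem_sup (add_mem hk (mul_mem_mul_pow_of_mem_pow_pred ha hl))
        (Ideal.mul_mem_left _ _ (Ideal.mem_span_singleton_self _))
  exact fun d g hg hbg => mem_of_forall_mem_sup_pow (hI ha) fun N => key N d g hg hbg

theorem RegularModulo.swap {I K : Ideal R} {a b : R} (hb : b ∈ I)
    (hab : RegularModulo I (K ⊔ Ideal.span {a}) b) (hKa : RegularModulo I K a) :
    RegularModulo I (K ⊔ Ideal.span {b}) a := by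
  intro d g hg hag
  obtain ⟨k, hk, h, hh, hkh⟩ := exists_add_mul_of_mem_sup_span_mul hag
  have h1 : b * h ∈ (K ⊔ Ideal.span {a}) * I ^ d := by
    rw [show b * h = -k + a * g by rw [hkh]; ring]
    exact add_mul_mem_sup_span_mul (neg_mem hk) hg
  obtain ⟨k', hk', h', hh', rfl⟩ := exists_add_mul_of_mem_sup_span_mul (hab d h hh h1)
  have h2 : a * (g - b * h') ∈ K * I ^ d := by
    have := add_mem hk (mul_mem_mul_pow_of_mem_pow_pred hb hk')
    rwa [show k + b * k' = a * (g - b * h') by rw [mul_sub, hkh]; ring] at this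
  have h3 := hKa d _ (sub_mem hg (mul_mem_pow_of_mem_pow_pred hb hh')) h2
  rw [show g = (g - b * h') + b * h' by ring]
  exact add_mul_mem_sup_span_mul h3 hh'

variable {ι : Type*}

/-- Each member of the family `z` on `A` is regular modulo every subfamily of the others. -/
def IsPermutablyRegular (I : Ideal R) (z : ι → R) (A : Finset ι) : Prop :=
  ∀ T ⊆ A, ∀ i ∈ A, i ∉ T → RegularModulo I (Ideal.span (z '' T)) (z i)

theorem span_image_insert [DecidableEq ι] (z : ι → R) (T : Finset ι) (a : ι) :
    Ideal.span (z '' (insert a T : Finset ι)) = Ideal.span (z '' T) ⊔ Ideal.span {z a} := by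
  rw [Finset.coe_insert, Set.image_insert_eq, Ideal.span_insert, sup_comm]

theorem IsPermutablyRegular.congr {I : Ideal R} {z z' : ι → R} {A : Finset ι}
    (h : IsPermutablyRegular I z A) (hz : ∀ i ∈ A, z i = z' i) : IsPermutablyRegular I z' A := by
  intro T hT i hi hiT
  rw [← hz i hi, ← Set.image_congr fun j hj => hz j (hT hj)]
  exact h T hT i hi hiT

theorem IsPermutablyRegular.mono {I : Ideal R} {z : ι → R} {A B : Finset ι}
    (h : IsPermutablyRegular I z A) (hB : B ⊆ A) : IsPermutablyRegular I z B :=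
  fun T hT i hi hiT => h T (hT.trans hB) i (hB hi) hiT

theorem IsPermutablyRegular.insert [DecidableEq ι] [IsLocalRing R] [IsNoetherianRing R] {I : Ideal R}
    {z : ι → R} {A : Finset ι} {b : ι} (hI : I ≤ maximalIdeal R) (hz : ∀ i, z i ∈ I)
    (h : IsPermutablyRegular I z A) (hb : RegularModulo I (Ideal.span (z '' A)) (z b)) :
    IsPermutablyRegular I z (insert b A) := by
  -- The elements of D are removed from the modulus one at a time; each is regular modulo what
  -- remains, so `RegularModulo.of_sup` applies.
  have key : ∀ D ⊆ A, RegularModulo I (Ideal.span (z '' ((A \ D : Finset ι)))) (z b) := by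
    intro D
    induction D using Finset.induction_on with
    | empty => intro _; simpa using hb
    | insert a D ha ih =>
      intro hD
      have haA : a ∈ A := hD (Finset.mem_insert_self a D)
      have h1 := ih ((Finset.subset_insert a D).trans hD)
      have h2 : A \ D = Insert.insert a (A \ Insert.insert a D) := by
        ext j; simp only [Finset.mem_sdiff, Finset.mem_insert]
        by_cases hj : j = a
        · subst hj; simp [haA, ha]
        · simp [hj]
      rw [h2, span_image_insert] at h1
      exact h1.of_sup hI (hz a) (hz b) (h _ Finset.sdiff_subset a haA (by simp))
  have key' : ∀ T ⊆ A, RegularModulo I (Ideal.span (z '' T)) (z b) := by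
    intro T hT
    have := key (A \ T) Finset.sdiff_subset
    rwa [Finset.sdiff_sdiff_eq_self hT] at this
  intro T hT i hi hiT
  by_cases hib : i = b
  · subst hib
    exact key' T ((Finset.subset_insert_iff_of_notMem hiT).mp hT)
  · have hiA : i ∈ A := (Finset.mem_insert.mp hi).resolve_left hib
    by_cases hbT : b ∈ T
    · have hTA : T.erase b ⊆ A := Finset.subset_insert_iff.mp hT
      rw [← Finset.insert_erase hbT, span_image_insert]
      refine RegularModulo.swap (hz b) ?_
        (h _ hTA i hiA fun hi' => hiT (Finset.mem_of_mem_erase hi'))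
      rw [← span_image_insert]
      exact key' _ (Finset.insert_subset hiA hTA)
    · exact h T ((Finset.subset_insert_iff_of_notMem hbT).mp hT) i hiA hiT

end RegularModulo

/-! ### Exchanging one generator of a reduction -/

section ChangeOfReduction

variable {R : Type*} [CommRing R]

/-- Modulo K, a ^ (N + 1) is a multiple b * w with w ∈ I ^ N, so whatever b kills is killed by a ^
(N + 1). Cancelling a that many times loses exactly the degrees gained. -/
theorem RegularModulo.of_pow_mem {I K : Ideal R} {a b : R} {N : ℕ} (ha : a ∈ I)
    (hKa : RegularModulo I K a) (hN : a ^ (N + 1) ∈ (K ⊔ Ideal.span {b}) * I ^ N) :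
    RegularModulo I K b := by
  have key : ∀ M d : ℕ, ∀ g ∈ I ^ d, a ^ (M + 1) * g ∈ K * I ^ (M + d) →
      g ∈ K * I ^ (d - 1) := by
    intro M
    induction M with
    | zero => intro d g hg h; exact hKa d g hg (by simpa using h)
    | succ M ih =>
      intro d g hg h
      refine ih d g hg ?_
      have h1 : a ^ (M + 1) * g ∈ I ^ (M + 1 + d) := by
        rw [pow_add]; exact Ideal.mul_mem_mul (Ideal.pow_mem_pow ha _) hg
      have h2 := hKa _ _ h1 (by rwa [← mul_assoc, ← pow_succ'])
      rwa [show M + 1 + d - 1 = M + d by omega] at h2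
  intro d g hg hbg
  obtain ⟨k, hk, w, hw, hkw⟩ := exists_add_mul_of_mem_sup_span_mul hN
  refine key N d g hg ?_
  rw [hkw, show (k + b * w) * g = k * g + w * (b * g) by ring]
  refine add_mem ?_ ?_
  · rw [pow_add, ← mul_assoc]; exact Ideal.mul_mem_mul hk hg
  · rw [pow_add, mul_left_comm]; exact Ideal.mul_mem_mul hw hbg

/-- For w ∈ I ^ r, expand b * w by `h1` and then its a-coefficient by `h2`: modulo K this gives b *
w = a * b * u, and b can be cancelled. -/
theorem pow_le_mul_pow_pred_of_regularModulo {I K : Ideal R} {a b : R} {r : ℕ} (ha : a ∈ I)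
    (hb : b ∈ I) (hKb : RegularModulo I K b)
    (h1 : I ^ (r + 1) ≤ (K ⊔ Ideal.span {a}) * I ^ r)
    (h2 : I ^ r ≤ (K ⊔ Ideal.span {b}) * I ^ (r - 1)) :
    I ^ r ≤ (K ⊔ Ideal.span {a}) * I ^ (r - 1) := by
  intro w hw
  have h3 : b * w ∈ I ^ (r + 1) := by rw [pow_succ']; exact Ideal.mul_mem_mul hb hw
  obtain ⟨k, hk, v, hv, hkv⟩ := exists_add_mul_of_mem_sup_span_mul (h1 h3)
  obtain ⟨k', hk', u, hu, rfl⟩ := exists_add_mul_of_mem_sup_span_mul (h2 hv)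
  have h4 : b * (w - a * u) ∈ K * I ^ r := by
    rw [mul_sub, hkv, show k + a * (k' + b * u) - b * (a * u) = k + a * k' by ring]
    exact add_mem hk (mul_mem_mul_pow_of_mem_pow_pred ha hk')
  have h5 := hKb r _ (sub_mem hw (mul_mem_pow_of_mem_pow_pred ha hu)) h4
  rw [show w = (w - a * u) + a * u by ring]
  exact add_mul_mem_sup_span_mul h5 hu

end ChangeOfReduction

/-! ### Elementwise form of regular sequences -/

section SequenceExtraction

theorem mem_ofList_take_of_isWeaklyRegular {A : Type*} [CommRing A] {l : List A}
    (h : RingTheory.Sequence.IsWeaklyRegular A l) {i : ℕ} (hi : i < l.length) {g : A}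
    (hg : l[i] * g ∈ Ideal.ofList (l.take i)) : g ∈ Ideal.ofList (l.take i) := by
  have h1 := h.regular_mod_prev i hi
  have h2 : ∀ u : A, (Submodule.Quotient.mk u :
      A ⧸ (Ideal.ofList (l.take i) • ⊤ : Submodule A A)) = 0 ↔ u ∈ Ideal.ofList (l.take i) := by
    intro u; rw [Submodule.Quotient.mk_eq_zero]; simp
  rw [← h2]
  apply h1
  dsimp only
  rw [smul_zero, ← Submodule.Quotient.mk_smul, smul_eq_mul, h2]
  exact hg

theorem ofList_take_map_dropLast_ofFn {R A : Type*} [CommRing A] {s : ℕ} (x : Fin s → R)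
    (f : R → A) {i : ℕ} (hi : i < s) :
    Ideal.ofList (((List.ofFn x).dropLast.map f).take i) =
      Ideal.span ((fun j => f (x j)) '' {j | (j : ℕ) < i}) := by
  unfold Ideal.ofList
  congr 1
  ext a
  simp only [Set.mem_ofPred_eq, Set.mem_image, List.mem_take_iff_getElem]
  constructor
  · rintro ⟨j, hj, rfl⟩
    simp at hj
    exact ⟨⟨j, by omega⟩, by simp; omega, by simp⟩
  · rintro ⟨j, hj, rfl⟩
    exact ⟨j, by simp; omega, by simp⟩

theorem ofList_take_ofFn {A : Type*} [CommRing A] {s : ℕ} (x : Fin s → A) (i : ℕ) :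
    Ideal.ofList ((List.ofFn x).take i) = Ideal.span (x '' {j | (j : ℕ) < i}) := by
  unfold Ideal.ofList
  congr 1
  ext a
  simp only [Set.mem_ofPred_eq, Set.mem_image, List.mem_take_iff_getElem]
  constructor
  · rintro ⟨j, hj, rfl⟩
    simp at hj
    exact ⟨⟨j, by omega⟩, by simp; omega, by simp⟩
  · rintro ⟨j, hj, rfl⟩
    exact ⟨j, by simp; omega, by simp⟩

end SequenceExtraction

/-! ### Regularity of initial forms, read in the ring R -/

section InitialForms

variable {R : Type*} [CommRing R]

theorem initialForm_eq_of_mem_of_notMem {I : Ideal R} {a : R} {n : ℕ} (h : a ∈ I ^ n)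
    (h' : a ∉ I ^ (n + 1)) :
    initialForm I a = Ideal.Quotient.mk _ (reesMonomial I n a h) := by
  have hex : ∃ n : ℕ, a ∈ I ^ n ∧ a ∉ I ^ (n + 1) := ⟨n, h, h'⟩
  have hn : hex.choose = n := by
    have hs := hex.choose_spec
    rcases lt_trichotomy hex.choose n with hlt | heq | hgt
    · exact absurd (Ideal.pow_le_pow_right hlt h) hs.2
    · exact heq
    · exact absurd (Ideal.pow_le_pow_right hgt hs.1) h'
  rw [initialForm, dif_pos hex]
  simp only [hn]

theorem coeff_mem_of_mem_map {I : Ideal R} {p : reesAlgebra I}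
    (hp : p ∈ I.map (algebraMap R (reesAlgebra I))) (e : ℕ) :
    (p : Polynomial R).coeff e ∈ I ^ (e + 1) := by
  induction hp using Submodule.span_induction generalizing e with
  | mem p hp =>
    obtain ⟨a, ha, rfl⟩ := hp
    change (Polynomial.C a).coeff e ∈ _
    rw [Polynomial.coeff_C]
    split_ifs with he
    · subst he; simpa using ha
    · exact zero_mem _
  | zero => simp
  | add p q _ _ hp hq => simpa using add_mem (hp e) (hq e)
  | smul q p _ hp =>
    change ((q : Polynomial R) * (p : Polynomial R)).coeff e ∈ _
    rw [Polynomial.coeff_mul]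
    refine Ideal.sum_mem _ fun c hc => ?_
    rw [← Finset.HasAntidiagonal.mem_antidiagonal.mp hc, add_assoc, pow_add]
    exact Ideal.mul_mem_mul (q.2 c.1) (hp c.2)

theorem exists_monomial_of_mem_span_mul_pow {I : Ideal R} {B : Ideal (reesAlgebra I)} {S : Set R}
    {c : ℕ} (hS : ∀ a ∈ S, ∃ p ∈ B, (p : Polynomial R) = Polynomial.monomial c a) {e : ℕ} {k : R}
    (hk : k ∈ Ideal.span S * I ^ e) :
    ∃ p ∈ B, (p : Polynomial R) = Polynomial.monomial (c + e) k := by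
  have hS' : ∀ a ∈ Ideal.span S, ∃ p ∈ B, (p : Polynomial R) = Polynomial.monomial c a := by
    intro a ha
    induction ha using Submodule.span_induction with
    | mem a ha => exact hS a ha
    | zero => exact ⟨0, zero_mem _, by simp⟩
    | add a b _ _ ha hb =>
      obtain ⟨p, hp, hpa⟩ := ha
      obtain ⟨q, hq, hqb⟩ := hb
      exact ⟨p + q, add_mem hp hq, by simp [hpa, hqb]⟩
    | smul u a _ ha =>
      obtain ⟨p, hp, hpa⟩ := ha
      refine ⟨algebraMap R _ u * p, Ideal.mul_mem_left _ _ hp, ?_⟩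
      change Polynomial.C u * (p : Polynomial R) = _
      rw [hpa, Polynomial.C_mul_monomial, smul_eq_mul]
  induction hk using Submodule.mul_induction_on' with
  | mem_mul_mem a ha b hb =>
    obtain ⟨p, hp, hpa⟩ := hS' a ha
    refine ⟨p * reesMonomial I e b hb, Ideal.mul_mem_right _ _ hp, ?_⟩
    change (p : Polynomial R) * Polynomial.monomial e b = _
    rw [hpa, Polynomial.monomial_mul_monomial]
  | add a _ b _ ha hb =>
    obtain ⟨p, hp, hpa⟩ := ha
    obtain ⟨q, hq, hqb⟩ := hb
    exact ⟨p + q, add_mem hp hq, by simp [hpa, hqb]⟩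

/-- This is regularity of xᵢ* in degree e of G(I), lifted to R. As xᵢ ∉ I ^ 2, its initial form is
the class of xᵢ t. The first summand of the conclusion carries no power of I: taking coefficients
gives this directly, and it suffices for the approximation in
`span_inf_pow_le_of_initialForms_regular`. -/
theorem mem_sup_pow_of_initialForms_isWeaklyRegular {I : Ideal R} {s : ℕ} {x : Fin s → R}
    (hx : ∀ i, x i ∈ I) (hx' : ∀ i, x i ∉ I ^ 2)
    (hG : RingTheory.Sequence.IsWeaklyRegular (AssociatedGraded I)
      ((List.ofFn x).dropLast.map (initialForm I)))
    (i : Fin s) (hi : (i : ℕ) + 1 < s) (e : ℕ) (h : R) (hh : h ∈ I ^ e)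
    (hxh : x i * h ∈ Ideal.span (x '' {j | (j : ℕ) < i}) * I ^ e ⊔ I ^ (e + 2)) :
    h ∈ Ideal.span (x '' {j | (j : ℕ) < i}) ⊔ I ^ (e + 1) := by
  set π := Ideal.Quotient.mk (I.map (algebraMap R (reesAlgebra I))) with hπ
  set X : Fin s → reesAlgebra I := reesGenerators I x hx with hX
  have hform : ∀ j, initialForm I (x j) = π (X j) := fun j =>
    initialForm_eq_of_mem_of_notMem (by simpa using hx j) (by simpa using hx' j)
  have hlen : (i : ℕ) < ((List.ofFn x).dropLast.map (initialForm I)).length := by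
    simp; omega
  have htake : Ideal.ofList (((List.ofFn x).dropLast.map (initialForm I)).take i) =
      (Ideal.span (X '' {j | (j : ℕ) < i})).map π := by
    rw [ofList_take_map_dropLast_ofFn (A := AssociatedGraded I) x (initialForm I) i.2, Ideal.map_span, ← Set.image_comp]
    congr 1
    exact Set.image_congr fun j _ => hform j
  have hget : ((List.ofFn x).dropLast.map (initialForm I))[(i : ℕ)] = π (X i) := by
    simp [hform]
  have hmem : π (reesMonomial I e h hh) ∈ (Ideal.span (X '' {j | (j : ℕ) < i})).map π := by
    rw [← htake]
    refine mem_ofList_take_of_isWeaklyRegular hG hlen ?_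
    rw [htake, hget, ← map_mul]
    obtain ⟨k, hk, v, hv, hkv⟩ := Submodule.mem_sup.mp hxh
    -- The product xᵢ h splits into a part from the earlier xⱼ t, in degree one (`c := 1`), and a
    -- part in I ^ (e + 2) that vanishes in G(I), coming from I in degree zero (`c := 0`).
    obtain ⟨p, hp, hpk⟩ := exists_monomial_of_mem_span_mul_pow (c := 1)
      (B := Ideal.span (X '' {j | (j : ℕ) < i})) (by
        rintro _ ⟨j, hj, rfl⟩
        exact ⟨X j, Ideal.subset_span ⟨j, hj, rfl⟩, rfl⟩) hk
    obtain ⟨q, hq, hqv⟩ := exists_monomial_of_mem_span_mul_pow (I := I) (c := 0) (S := I)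
      (e := e + 1) (k := v) (B := I.map (algebraMap R (reesAlgebra I))) (by
        intro a ha
        exact ⟨algebraMap R _ a, Ideal.mem_map_of_mem _ ha, rfl⟩)
        (by rwa [Ideal.span_eq, ← pow_succ'])
    have hsum : X i * reesMonomial I e h hh = p + q := by
      apply Subtype.ext
      change Polynomial.monomial 1 (x i) * Polynomial.monomial e h =
        (p : Polynomial R) + (q : Polynomial R)
      rw [hpk, hqv, Polynomial.monomial_mul_monomial, ← hkv, map_add, add_comm 1 e, zero_add]
    rw [hsum, map_add, Ideal.Quotient.eq_zero_iff_mem.mpr hq, add_zero]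
    exact Ideal.mem_map_of_mem _ hp
  rw [hπ, Ideal.mem_quotient_iff_mem_sup] at hmem
  obtain ⟨p, hp, q, hq, hpq⟩ := Submodule.mem_sup.mp hmem
  have hpq' : (p : Polynomial R).coeff e + (q : Polynomial R).coeff e = h := by
    have := congrArg (fun u : reesAlgebra I => (u : Polynomial R).coeff e) hpq
    simpa [reesMonomial] using this
  rw [← hpq']
  refine Submodule.add_mem_sup ?_ (coeff_mem_of_mem_map hq e)
  have hle : Ideal.span (X '' {j | (j : ℕ) < i}) ≤
      ((Ideal.span (x '' {j | (j : ℕ) < i})).map Polynomial.C).comap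
        (reesAlgebra I).val.toRingHom := by
    rw [Ideal.span_le]
    rintro _ ⟨j, hj, rfl⟩
    refine Ideal.mem_map_C_iff.mpr fun n => ?_
    change (Polynomial.monomial 1 (x j)).coeff n ∈ _
    rw [Polynomial.coeff_monomial]
    split_ifs
    · exact Ideal.subset_span ⟨j, hj, rfl⟩
    · exact zero_mem _
  exact Ideal.mem_map_C_iff.mp (hle hp) e

end InitialForms

/-! ### The Valabrega–Valla intersection property -/

section ValabregaValla

variable {R : Type*} [CommRing R]

theorem span_image_lt_succ {s : ℕ} (x : Fin s → R) {i : ℕ} (hi : i < s) :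
    Ideal.span (x '' {j | (j : ℕ) < i + 1}) =
      Ideal.span (x '' {j | (j : ℕ) < i}) ⊔ Ideal.span {x ⟨i, hi⟩} := by
  rw [sup_comm, ← Ideal.span_insert, ← Set.image_insert_eq]
  congr 2
  ext j
  simp only [Set.mem_ofPred_eq, Set.mem_insert_iff, Fin.ext_iff]
  omega

theorem span_inf_pow_le_of_initialForms_regular {I : Ideal R} {s : ℕ} {x : Fin s → R}
    (hx : ∀ i, x i ∈ I)
    (hG : ∀ i : Fin s, (i : ℕ) + 1 < s → ∀ e : ℕ, ∀ h ∈ I ^ e,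
      x i * h ∈ Ideal.span (x '' {j | (j : ℕ) < i}) * I ^ e ⊔ I ^ (e + 2) →
      h ∈ Ideal.span (x '' {j | (j : ℕ) < i}) ⊔ I ^ (e + 1))
    (i : ℕ) (hi : i < s) (n : ℕ) :
    Ideal.span (x '' {j | (j : ℕ) < i}) ⊓ I ^ n ≤
      Ideal.span (x '' {j | (j : ℕ) < i}) * I ^ (n - 1) := by
  induction i generalizing n with
  | zero => simp
  | succ i ih =>
    have his : i < s := by omega
    set K := Ideal.span (x '' {j | (j : ℕ) < i}) with hK
    rw [span_image_lt_succ x his, ← hK]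
    rintro u ⟨hu, hun⟩
    -- Successive approximation: the coefficient h of the last generator is pushed into higher
    -- powers of I. The induction on i places u - xᵢ h in K * I ^ e, so regularity of xᵢ* improves h
    -- by one degree.
    have key : ∀ e ≤ n - 1, ∃ h ∈ I ^ e, u - x ⟨i, his⟩ * h ∈ K := by
      intro e
      induction e with
      | zero =>
        intro _
        obtain ⟨k, hk, w, hw, rfl⟩ := Submodule.mem_sup.mp hu
        obtain ⟨h, rfl⟩ := Ideal.mem_span_singleton'.mp hw
        exact ⟨h, by simp, by simpa [mul_comm] using hk⟩
      | succ e ihe =>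
        intro he
        obtain ⟨h, hh, hk⟩ := ihe (by omega)
        have h1 : x ⟨i, his⟩ * h ∈ K * I ^ e ⊔ I ^ (e + 2) := by
          have h2 : u ∈ I ^ (e + 2) := Ideal.pow_le_pow_right (by omega) hun
          have h3 : u - x ⟨i, his⟩ * h ∈ I ^ (e + 1) := by
            refine sub_mem (Ideal.pow_le_pow_right (by omega) hun) ?_
            rw [pow_succ']
            exact Ideal.mul_mem_mul (hx _) hh
          have h4 := ih his (e + 1) ⟨hk, h3⟩
          rw [show x ⟨i, his⟩ * h = -(u - x ⟨i, his⟩ * h) + u by ring]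
          exact Submodule.add_mem_sup (neg_mem h4) h2
        obtain ⟨k, hk', h', hh', rfl⟩ := Submodule.mem_sup.mp (hG ⟨i, his⟩ hi e h hh h1)
        refine ⟨h', hh', ?_⟩
        rw [show u - x ⟨i, his⟩ * h' = (u - x ⟨i, his⟩ * (k + h')) + x ⟨i, his⟩ * k by ring]
        exact add_mem hk (Ideal.mul_mem_left _ _ hk')
    obtain ⟨h, hh, hk⟩ := key (n - 1) le_rfl
    rcases Nat.eq_zero_or_pos n with rfl | hn
    · simpa using hu
    have h1 : x ⟨i, his⟩ * h ∈ I ^ n := mul_mem_pow_of_mem_pow_pred (hx _) hh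
    have h2 := ih his n ⟨hk, sub_mem hun h1⟩
    rw [show u = (u - x ⟨i, his⟩ * h) + x ⟨i, his⟩ * h by ring]
    exact add_mul_mem_sup_span_mul h2 hh

theorem isPermutablyRegular_of_initialForms_isWeaklyRegular [IsLocalRing R] [IsNoetherianRing R]
    {I : Ideal R} {s : ℕ} {x : Fin s → R} (hI : I ≤ maximalIdeal R)
    (hx : ∀ i, x i ∈ I) (hx' : ∀ i, x i ∉ I ^ 2)
    (hreg : RingTheory.Sequence.IsWeaklyRegular R (List.ofFn x))
    (hG : RingTheory.Sequence.IsWeaklyRegular (AssociatedGraded I)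
      ((List.ofFn x).dropLast.map (initialForm I))) :
    IsPermutablyRegular I x Finset.univ := by
  -- Regularity in R puts g in the span K of the earlier elements, and K ∩ I ^ d ⊆ K * I ^ (d - 1).
  -- Only intersections with at most s - 1 generators occur, so the last initial form is not needed.
  have hmod : ∀ i : Fin s, RegularModulo I (Ideal.span (x '' {j | (j : ℕ) < i})) (x i) := by
    intro i d g hg hxg
    refine span_inf_pow_le_of_initialForms_regular hx
      (mem_sup_pow_of_initialForms_isWeaklyRegular hx hx' hG) i i.2 d ⟨?_, hg⟩
    rw [← ofList_take_ofFn]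
    refine mem_ofList_take_of_isWeaklyRegular hreg (by simp) ?_
    rw [ofList_take_ofFn]
    simpa using (Ideal.mul_le_inf hxg).1
  have key : ∀ n ≤ s, IsPermutablyRegular I x (Finset.univ.filter fun j : Fin s => (j : ℕ) < n) := by
    intro n
    induction n with
    | zero => intro _ T _ i hi; simp at hi
    | succ n ih =>
      intro hn
      have h1 : (Finset.univ.filter fun j : Fin s => (j : ℕ) < n + 1) =
          insert ⟨n, hn⟩ (Finset.univ.filter fun j : Fin s => (j : ℕ) < n) := by
        ext j; simp only [Finset.mem_filter_univ, Finset.mem_insert, Fin.ext_iff]; omega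
      rw [h1]
      refine (ih (by omega)).insert hI hx ?_
      simpa using hmod ⟨n, hn⟩
  have := key s le_rfl
  rwa [Finset.filter_true_of_mem fun j _ => j.2] at this

end ValabregaValla

/-! ### Equations of the Rees algebra, degree by degree -/

section ReesEquations

variable {R σ : Type*} [CommRing R]

open MvPolynomial

theorem coeff_aeval_reesGenerators {I : Ideal R} {z : σ → R} (hz : ∀ i, z i ∈ I)
    (p : MvPolynomial σ R) (n : ℕ) :
    (aeval (reesGenerators I z hz) p : Polynomial R).coeff n =
      eval z (homogeneousComponent n p) := by
  induction p using MvPolynomial.induction_on' with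
  | monomial d a =>
    have h : (aeval (reesGenerators I z hz) (monomial d a) : Polynomial R) =
        Polynomial.monomial d.degree (eval z (monomial d a)) := by
      rw [aeval_monomial, eval_monomial]
      change Polynomial.C a * (reesAlgebra I).val _ = _
      rw [Finsupp.prod, map_prod, Finsupp.prod, Finsupp.degree_apply]
      have h2 : ∀ i, (reesAlgebra I).val (reesGenerators I z hz i ^ d i) =
          Polynomial.monomial (d i) (z i ^ d i) := fun i => by
        rw [map_pow]
        change (Polynomial.monomial 1 (z i)) ^ d i = _
        rw [Polynomial.monomial_pow, one_mul]
      simp only [h2, ← Polynomial.C_mul_X_pow_eq_monomial, Finset.prod_mul_distrib,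
        Finset.prod_pow_eq_pow_sum, map_mul, map_prod, mul_assoc]
    rw [h, Polynomial.coeff_monomial, homogeneousComponent_of_mem (isHomogeneous_monomial a rfl)]
    by_cases hn : d.degree = n
    · rw [if_pos hn, if_pos hn.symm]
    · rw [if_neg hn, if_neg (Ne.symm hn), map_zero]
  | add p q hp hq => simp [hp, hq]

theorem mem_equations_reesGenerators_iff {I : Ideal R} {z : σ → R} (hz : ∀ i, z i ∈ I)
    {p : MvPolynomial σ R} :
    p ∈ equations R (reesGenerators I z hz) ↔ ∀ n, eval z (homogeneousComponent n p) = 0 := by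
  simp_rw [← coeff_aeval_reesGenerators hz]
  rw [equations, RingHom.mem_ker, ← Subtype.coe_inj, Polynomial.ext_iff]
  rfl

theorem mem_equations_reesGenerators_iff_of_isHomogeneous {I : Ideal R} {z : σ → R}
    (hz : ∀ i, z i ∈ I) {p : MvPolynomial σ R} {n : ℕ} (hp : p.IsHomogeneous n) :
    p ∈ equations R (reesGenerators I z hz) ↔ eval z p = 0 := by
  rw [mem_equations_reesGenerators_iff]
  constructor
  · intro h
    have := h n
    rwa [homogeneousComponent_eq_self hp] at this
  · intro h m
    rw [homogeneousComponent_of_mem hp]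
    split_ifs
    · exact h
    · simp

theorem aeval_reesGenerators_surjective {I : Ideal R} {z : σ → R}
    (hz : ∀ i, z i ∈ I) (hI : Ideal.span (Set.range z) = I) :
    Function.Surjective (aeval (R := R) (reesGenerators I z hz)) := by
  have key : ∀ n : ℕ, ∀ a : R, ∀ ha : a ∈ I ^ n, reesMonomial I n a ha ∈
      (aeval (R := R) (reesGenerators I z hz)).range := by
    intro n a ha
    have ha' := ha
    rw [← hI] at ha'
    obtain ⟨p, hp, rfl⟩ := (Ideal.mem_span_pow_iff_exists_isHomogeneous z a).mp ha'
    refine ⟨p, Subtype.ext (Polynomial.ext fun m => ?_)⟩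
    change (aeval (reesGenerators I z hz) p : Polynomial R).coeff m =
      (Polynomial.monomial n (eval z p)).coeff m
    rw [coeff_aeval_reesGenerators, homogeneousComponent_of_mem hp, Polynomial.coeff_monomial]
    by_cases h : n = m
    · rw [if_pos h, if_pos h.symm]
    · rw [if_neg h, if_neg (Ne.symm h), map_zero]
  intro u
  change u ∈ (aeval (R := R) (reesGenerators I z hz)).range
  have hu : u = ∑ n ∈ (u : Polynomial R).support, reesMonomial I n _ (u.2 n) := by
    apply Subtype.ext
    rw [AddSubmonoidClass.coe_finsetSum]
    exact (u : Polynomial R).as_sum_support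
  rw [hu]
  exact Subalgebra.sum_mem _ fun n _ => key n _ _

end ReesEquations

/-! ### Syzygies and generation of equations in high degree -/

section Syzygies

variable {R : Type*} [CommRing R]

open MvPolynomial

theorem exists_sum_of_mem_span_image_mul {ι : Type*} {x : ι → R} {L : Ideal R}
    {A : Finset ι} {u : R} (hu : u ∈ Ideal.span (x '' A) * L) :
    ∃ h : ι → R, (∀ i, h i ∈ L) ∧ u = ∑ i ∈ A, x i * h i := by
  classical
  induction A using Finset.induction_on generalizing u with
  | empty => exact ⟨0, by simp, by simpa using hu⟩
  | insert b A hb ih =>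
    rw [span_image_insert] at hu
    obtain ⟨k, hk, v, hv, rfl⟩ := exists_add_mul_of_mem_sup_span_mul hu
    obtain ⟨h, hh, rfl⟩ := ih hk
    refine ⟨Function.update h b v, fun i => ?_, ?_⟩
    · by_cases hi : i = b
      · subst hi; simpa using hv
      · simpa [hi] using hh i
    · rw [Finset.sum_insert hb, Function.update_self, add_comm]
      congr 1
      refine Finset.sum_congr rfl fun i hi => ?_
      rw [Function.update_of_ne (by rintro rfl; exact hb hi)]

theorem sum_mul_mem_span_image_mul {ι : Type*} {x : ι → R} {L : Ideal R}
    {A : Finset ι} {h : ι → R} (hh : ∀ i ∈ A, h i ∈ L) :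
    ∑ i ∈ A, x i * h i ∈ Ideal.span (x '' A) * L :=
  Ideal.sum_mem _ fun i hi =>
    Ideal.mul_mem_mul (Ideal.subset_span (Set.mem_image_of_mem x hi)) (hh i hi)

variable {σ ι : Type*} {I : Ideal R} {z : σ → R}

theorem eval_mem_pow_of_isHomogeneous (hI : Ideal.span (Set.range z) = I)
    {p : MvPolynomial σ R} {n : ℕ} (hp : p.IsHomogeneous n) : eval z p ∈ I ^ n := by
  rw [← hI, Ideal.mem_span_pow_iff_exists_isHomogeneous]
  exact ⟨p, hp, rfl⟩

theorem exists_isHomogeneous_of_mem_pow (hI : Ideal.span (Set.range z) = I)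
    {a : R} {n : ℕ} (ha : a ∈ I ^ n) : ∃ p : MvPolynomial σ R, p.IsHomogeneous n ∧ eval z p = a := by
  rwa [← hI, Ideal.mem_span_pow_iff_exists_isHomogeneous] at ha

/-- The relation ∑ xᵢ gᵢ = 0 is a combination of Koszul syzygies with coefficients in I ^ n. Lifting
these to forms of degree n alters the Gᵢ without altering ∑ Xᵢ Gᵢ and makes each one vanish at z. -/
theorem exists_sum_X_mul_eq_of_isPermutablyRegular [DecidableEq ι] (hI : Ideal.span (Set.range z) = I)
    (f : ι → σ) {A : Finset ι} (hA : IsPermutablyRegular I (z ∘ f) A) {n : ℕ}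
    {G : ι → MvPolynomial σ R} (hG : ∀ i, (G i).IsHomogeneous (n + 1))
    (h : eval z (∑ i ∈ A, X (f i) * G i) = 0) :
    ∃ G' : ι → MvPolynomial σ R, (∀ i, (G' i).IsHomogeneous (n + 1)) ∧
      (∀ i, eval z (G' i) = 0) ∧ ∑ i ∈ A, X (f i) * G i = ∑ i ∈ A, X (f i) * G' i := by
  induction A using Finset.induction_on generalizing G with
  | empty => exact ⟨0, fun _ => isHomogeneous_zero _ _ _, by simp, by simp⟩
  | insert b A hb ih =>
    have hsum : z (f b) * eval z (G b) = ∑ i ∈ A, z (f i) * -eval z (G i) := by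
      rw [Finset.sum_insert hb] at h
      simp only [map_add, map_mul, map_sum, eval_X] at h
      simp only [mul_neg, Finset.sum_neg_distrib]
      exact eq_neg_of_add_eq_zero_left h
    -- Filtered regularity, rather than plain regularity, is what gives coefficients in I ^ n and
    -- hence lifts of the right degree.
    have hGb : eval z (G b) ∈ Ideal.span ((z ∘ f) '' A) * I ^ n := by
      refine hA A (Finset.subset_insert b A) b (Finset.mem_insert_self b A) hb (n + 1) _
        (eval_mem_pow_of_isHomogeneous hI (hG b)) ?_
      rw [Function.comp_apply, hsum]
      exact sum_mul_mem_span_image_mul (x := z ∘ f)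
        fun i _ => neg_mem (eval_mem_pow_of_isHomogeneous hI (hG i))
    obtain ⟨u, hu, hsum'⟩ := exists_sum_of_mem_span_image_mul hGb
    choose H hH hHu using fun i => exists_isHomogeneous_of_mem_pow hI (hu i)
    have hXH : ∀ i j, (X (f i) * H j).IsHomogeneous (n + 1) := fun i j => by
      rw [add_comm]; exact (isHomogeneous_X R (f i)).mul (hH j)
    have hGH : ∀ i, (G i + X (f b) * H i).IsHomogeneous (n + 1) := fun i => (hG i).add (hXH b i)
    have hG0 : eval z (G b - ∑ i ∈ A, X (f i) * H i) = 0 := by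
      simp only [map_sub, map_sum, map_mul, eval_X, hHu]
      rw [hsum', sub_eq_zero]; rfl
    have hrew : ∑ i ∈ insert b A, X (f i) * G i = X (f b) * (G b - ∑ i ∈ A, X (f i) * H i) +
        ∑ i ∈ A, X (f i) * (G i + X (f b) * H i) := by
      rw [Finset.sum_insert hb, mul_sub, Finset.mul_sum]
      simp only [mul_add, Finset.sum_add_distrib]
      have : ∑ i ∈ A, X (f b) * (X (f i) * H i) = ∑ i ∈ A, X (f i) * (X (f b) * H i) :=
        Finset.sum_congr rfl fun i _ => mul_left_comm _ _ _
      rw [this]; ring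
    obtain ⟨G', hG', hG'0, hsumG'⟩ := ih (hA.mono (Finset.subset_insert b A)) hGH (by
      rw [hrew, map_add, map_mul, hG0, mul_zero, zero_add] at h
      exact h)
    refine ⟨Function.update G' b (G b - ∑ i ∈ A, X (f i) * H i), fun i => ?_, fun i => ?_, ?_⟩
    · by_cases hi : i = b
      · subst hi
        rw [Function.update_self]
        exact (hG i).sub (IsHomogeneous.sum _ _ _ fun j _ => hXH j j)
      · rw [Function.update_of_ne hi]; exact hG' i
    · by_cases hi : i = b
      · subst hi
        rw [Function.update_self]; exact hG0
      · rw [Function.update_of_ne hi]; exact hG'0 i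
    · rw [hrew, hsumG', Finset.sum_insert hb, Function.update_self]
      congr 1
      refine Finset.sum_congr rfl fun i hi => ?_
      rw [Function.update_of_ne (by rintro rfl; exact hb hi)]

theorem exists_eq_C_mul_X_none_pow_add_sum [Fintype ι] {n : ℕ} {p : MvPolynomial (Option ι) R}
    (hp : p.IsHomogeneous (n + 1)) :
    ∃ (c : R) (G : ι → MvPolynomial (Option ι) R), (∀ i, (G i).IsHomogeneous n) ∧
      p = C c * X none ^ (n + 1) + ∑ i, X (some i) * G i := by
  classical
  let q : MvPolynomial (Option ι) R → Prop := fun p =>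
    ∃ (c : R) (G : ι → MvPolynomial (Option ι) R), (∀ i, (G i).IsHomogeneous n) ∧
      p = C c * X none ^ (n + 1) + ∑ i, X (some i) * G i
  change q p
  rw [p.as_sum]
  refine Finset.sum_induction _ q ?_ ?_ ?_
  · rintro _ _ ⟨c, G, hG, rfl⟩ ⟨c', G', hG', rfl⟩
    refine ⟨c + c', G + G', fun i => (hG i).add (hG' i), ?_⟩
    simp only [Pi.add_apply, mul_add, Finset.sum_add_distrib, map_add]
    ring
  · exact ⟨0, 0, fun _ => isHomogeneous_zero _ _ _, by simp⟩
  · intro d hd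
    have hdeg : d.degree = n + 1 := by
      by_contra hne
      exact (mem_support_iff.mp hd) (hp.coeff_eq_zero hne)
    by_cases h : ∃ i, d (some i) ≠ 0
    · obtain ⟨i, hi⟩ := h
      have hle : Finsupp.single (some i) 1 ≤ d := by
        rw [Finsupp.single_le_iff]; omega
      refine ⟨0, Pi.single i (monomial (d - Finsupp.single (some i) 1) (coeff d p)), ?_, ?_⟩
      · intro j
        by_cases hj : j = i
        · subst hj
          rw [Pi.single_eq_same]
          refine isHomogeneous_monomial _ ?_
          have := congrArg Finsupp.degree (tsub_add_cancel_of_le hle)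
          rw [map_add, Finsupp.degree_single, hdeg] at this
          omega
        · rw [Pi.single_eq_of_ne hj]; exact isHomogeneous_zero _ _ _
      · rw [Finset.sum_eq_single i (by intro j _ hj; rw [Pi.single_eq_of_ne hj, mul_zero])
          (by simp), Pi.single_eq_same, map_zero, zero_mul, zero_add, X, monomial_mul, one_mul,
          add_tsub_cancel_of_le hle]
    · push Not at h
      have hd' : d = Finsupp.single none (n + 1) := by
        have hd1 : d = Finsupp.single none (d none) := by
          ext o
          cases o with
          | none => simp
          | some i => simp [h i]
        rw [hd1, Finsupp.degree_single] at hdeg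
        rw [hd1, hdeg]
      refine ⟨coeff d p, 0, fun _ => isHomogeneous_zero _ _ _, ?_⟩
      rw [hd', X_pow_eq_monomial, C_mul_monomial, mul_one]
      simp

/-- Above degree r, the pure power of Y is cleared with P; the rest is ∑ Xᵢ Gᵢ, which the syzygy
lemma rewrites through equations one degree lower. -/
theorem mem_span_sup_equationsUpTo [Fintype ι] [DecidableEq ι] {z : Option ι → R}
    (hz : ∀ o, z o ∈ I) (hI : Ideal.span (Set.range z) = I)
    (hreg : IsPermutablyRegular I (z ∘ some) Finset.univ) {r : ℕ} (hr : 0 < r)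
    {F : ι → MvPolynomial (Option ι) R} (hF : ∀ i, (F i).IsHomogeneous r)
    (hF0 : eval z (X none ^ (r + 1) - ∑ i, X (some i) * F i) = 0) {n : ℕ}
    {p : MvPolynomial (Option ι) R} (hp : p.IsHomogeneous n) (hp0 : eval z p = 0) :
    p ∈ Ideal.span {X none ^ (r + 1) - ∑ i, X (some i) * F i} ⊔
      equationsUpTo R (reesGenerators I z hz) r := by
  induction n generalizing p with
  | zero =>
    exact Ideal.mem_sup_right (Ideal.subset_span
      ⟨(mem_equations_reesGenerators_iff_of_isHomogeneous hz hp).mpr hp0, 0, by omega, hp⟩)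
  | succ n ih =>
    rcases Nat.lt_or_ge n r with hn | hn
    · exact Ideal.mem_sup_right (Ideal.subset_span
        ⟨(mem_equations_reesGenerators_iff_of_isHomogeneous hz hp).mpr hp0, n + 1, hn, hp⟩)
    obtain ⟨m, rfl⟩ : ∃ m, n = m + 1 := ⟨n - 1, by omega⟩
    obtain ⟨c, G, hG, rfl⟩ := exists_eq_C_mul_X_none_pow_add_sum hp
    set P₀ : MvPolynomial (Option ι) R := X none ^ (r + 1) - ∑ i, X (some i) * F i with hP₀
    have hmono : (C c * X none ^ (m + 1 - r) : MvPolynomial (Option ι) R).IsHomogeneous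
        (m + 1 - r) := (isHomogeneous_X_pow _ _).C_mul c
    have hG' : ∀ i, (G i + C c * X none ^ (m + 1 - r) * F i).IsHomogeneous (m + 1) := fun i => by
      have := hmono.mul (hF i)
      rw [Nat.sub_add_cancel hn] at this
      exact (hG i).add this
    have hrew : C c * X none ^ (m + 1 + 1) + ∑ i, X (some i) * G i =
        C c * X none ^ (m + 1 - r) * P₀ +
          ∑ i, X (some i) * (G i + C c * X none ^ (m + 1 - r) * F i) := by
      have h1 : (X none : MvPolynomial (Option ι) R) ^ (m + 1 + 1) =
          X none ^ (m + 1 - r) * X none ^ (r + 1) := by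
        rw [← pow_add]; congr 1; omega
      simp only [mul_add, Finset.sum_add_distrib, hP₀, mul_sub, h1, Finset.mul_sum]
      have h2 : ∑ i, X (some i) * (C c * X none ^ (m + 1 - r) * F i) =
          ∑ i, C c * X none ^ (m + 1 - r) * (X (some i) * F i) :=
        Finset.sum_congr rfl fun i _ => mul_left_comm _ _ _
      rw [h2]; ring
    rw [hrew] at hp0 ⊢
    rw [map_add, map_mul, hF0, mul_zero, zero_add] at hp0
    obtain ⟨G', hG', hG'0, hsum⟩ :=
      exists_sum_X_mul_eq_of_isPermutablyRegular hI some hreg hG' hp0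
    refine add_mem (Ideal.mem_sup_left (Ideal.mul_mem_left _ _ (Ideal.mem_span_singleton_self _))) ?_
    rw [hsum]
    exact Ideal.sum_mem _ fun i _ => Ideal.mul_mem_left _ _ (ih (hG' i) (hG'0 i))

end Syzygies

/-! ### General reductions and the absence of fiber equations of low degree -/

section GenericReduction

variable {R ι : Type*} [CommRing R] {I : Ideal R} {z : Option ι → R}

open _root_.MvPolynomial

/-- Modulo the elements xᵢ - cᵢ y, each xᵢ becomes cᵢ y, so a form of degree n becomes its value at
(c, 1) times y ^ n; homogeneity supplies the factor I ^ (n - 1). -/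
theorem eval_sub_mem_span_mul_pow [Fintype ι] (hz : ∀ o, z o ∈ I)
    (hI : Ideal.span (Set.range z) = I) (c : ι → R) {n : ℕ} {p : MvPolynomial (Option ι) R}
    (hp : p.IsHomogeneous n) :
    eval z p - eval (fun o => o.elim 1 c) p * z none ^ n ∈
      Ideal.span (Set.range fun i => z (some i) - c i * z none) * I ^ (n - 1) := by
  induction n generalizing p with
  | zero =>
    have hpC := totalDegree_eq_zero_iff_eq_C.mp ((totalDegree_zero_iff_isHomogeneous _).mpr hp)
    rw [hpC]
    simp
  | succ n ih =>
    obtain ⟨a, G, hG, rfl⟩ := exists_eq_C_mul_X_none_pow_add_sum hp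
    have hrew : eval z (C a * X none ^ (n + 1) + ∑ i, X (some i) * G i) -
        eval (fun o => o.elim 1 c) (C a * X none ^ (n + 1) + ∑ i, X (some i) * G i) *
          z none ^ (n + 1) =
        ∑ i, ((z (some i) - c i * z none) * eval z (G i) + c i * (z none *
          (eval z (G i) - eval (fun o => o.elim 1 c) (G i) * z none ^ n))) := by
      simp only [map_add, map_mul, map_sum, map_pow, eval_X, eval_C, Option.elim_none,
        Option.elim_some, one_pow, mul_one, add_mul, add_sub_add_left_eq_sub, Finset.sum_mul]
      rw [← Finset.sum_sub_distrib]
      exact Finset.sum_congr rfl fun i _ => by ring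
    rw [hrew, Nat.add_sub_cancel]
    refine Ideal.sum_mem _ fun i _ => add_mem ?_ (Ideal.mul_mem_left _ _ ?_)
    · exact Ideal.mul_mem_mul (Ideal.subset_span ⟨i, rfl⟩) (eval_mem_pow_of_isHomogeneous hI (hG i))
    · exact mul_mem_mul_pow_of_mem_pow_pred (hz none) (ih (hG i))

theorem pow_succ_le_span_mul_pow_of_isUnit_eval [Fintype ι] (hz : ∀ o, z o ∈ I)
    (hI : Ideal.span (Set.range z) = I) {c : ι → R} {n : ℕ} {p : MvPolynomial (Option ι) R}
    (hp : p.IsHomogeneous (n + 1)) (hp0 : eval z p = 0)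
    (hc : IsUnit (eval (fun o => o.elim 1 c) p)) :
    I ^ (n + 1) ≤ Ideal.span (Set.range fun i => z (some i) - c i * z none) * I ^ n := by
  have hy : z none ^ (n + 1) ∈
      Ideal.span (Set.range fun i => z (some i) - c i * z none) * I ^ n := by
    have h := eval_sub_mem_span_mul_pow hz hI c hp
    rw [hp0, zero_sub, neg_mem_iff, Nat.add_sub_cancel] at h
    exact (Ideal.unit_mul_mem_iff_mem _ hc).mp h
  intro u hu
  obtain ⟨q, hq, rfl⟩ := exists_isHomogeneous_of_mem_pow hI hu
  have h := eval_sub_mem_span_mul_pow hz hI c hq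
  rw [Nat.add_sub_cancel] at h
  simpa using add_mem h (Ideal.mul_mem_left _ (eval (fun o => o.elim 1 c) q) hy)

theorem span_range_eq_sup [Fintype ι] [DecidableEq ι] (w : ι → R) (b : ι) :
    Ideal.span (Set.range w) =
      Ideal.span (w '' (Finset.univ.erase b : Finset ι)) ⊔ Ideal.span {w b} := by
  rw [← span_image_insert, Finset.insert_erase (Finset.mem_univ b), Finset.coe_univ,
    Set.image_univ]

/-- With K spanned by the common members, the reduction `h'` gives w_b ^ (r + 1) ∈ (K + (w'_b)) * I
^ r, so regularity passes from w_b to w'_b. The bound on the reduction number travels in the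
opposite direction. -/
theorem IsPermutablyRegular.exchange [IsLocalRing R] [IsNoetherianRing R]
    [Fintype ι] [DecidableEq ι] (hIm : I ≤ maximalIdeal R) {w w' : ι → R} (hw : ∀ i, w i ∈ I)
    (hw' : ∀ i, w' i ∈ I) {b : ι} (hww : ∀ i, i ≠ b → w i = w' i)
    (hreg : IsPermutablyRegular I w Finset.univ) {r : ℕ}
    (h : I ^ (r + 1) ≤ Ideal.span (Set.range w) * I ^ r)
    (h' : I ^ (r + 1) ≤ Ideal.span (Set.range w') * I ^ r) :
    IsPermutablyRegular I w' Finset.univ ∧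
      (I ^ r ≤ Ideal.span (Set.range w') * I ^ (r - 1) →
        I ^ r ≤ Ideal.span (Set.range w) * I ^ (r - 1)) := by
  set T : Finset ι := Finset.univ.erase b with hT
  have hTb : ∀ i ∈ T, w i = w' i := fun i hi => hww i (Finset.ne_of_mem_erase hi)
  have himage : w '' T = w' '' T := Set.image_congr fun i hi => hTb i hi
  rw [span_range_eq_sup w b] at h
  rw [span_range_eq_sup w' b, ← hT, ← himage] at h'
  rw [span_range_eq_sup w' b, ← hT, ← himage, span_range_eq_sup w b]
  have hb : RegularModulo I (Ideal.span (w '' T)) (w' b) :=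
    (hreg T (Finset.subset_univ T) b (Finset.mem_univ b) (by simp [hT])).of_pow_mem (hw b)
      (h' (Ideal.pow_mem_pow (hw b) (r + 1)))
  refine ⟨?_, fun h2 => pow_le_mul_pow_pred_of_regularModulo (hw b) (hw' b) hb h h2⟩
  have := ((hreg.mono (Finset.subset_univ T)).congr hTb).insert hIm hw' (himage ▸ hb)
  rwa [hT, Finset.insert_erase (Finset.mem_univ b)] at this

theorem eval_mul_of_isHomogeneous {S σ : Type*} [CommRing S] {p : MvPolynomial σ S} {n : ℕ}
    (hp : p.IsHomogeneous n) (t : S) (v : σ → S) :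
    eval (fun o => t * v o) p = t ^ n * eval v p := by
  rw [eval_eq, eval_eq, Finset.mul_sum]
  refine Finset.sum_congr rfl fun d hd => ?_
  have hdeg : d.degree = n := by
    by_contra hne
    exact (mem_support_iff.mp hd) (hp.coeff_eq_zero hne)
  simp only [mul_pow, Finset.prod_mul_distrib, Finset.prod_pow_eq_pow_sum]
  rw [← Finsupp.degree_apply, hdeg]
  ring

/-- The subset A records which xᵢ have already been replaced by xᵢ - cᵢ y. An exchange changes a
single member, so every intermediate family must satisfy the inclusion in degree r + 1. -/
theorem pow_le_span_mul_pow_pred_of_forall_reduction [IsLocalRing R] [IsNoetherianRing R]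
    [Fintype ι] [DecidableEq ι] (hIm : I ≤ maximalIdeal R) {x : ι → R} (hx : ∀ i, x i ∈ I)
    {y : R} (hy : y ∈ I) (hreg : IsPermutablyRegular I x Finset.univ) {r : ℕ} (c : ι → R)
    (hred : ∀ A : Finset ι, I ^ (r + 1) ≤
      Ideal.span (Set.range fun i => x i - (if i ∈ A then c i else 0) * y) * I ^ r)
    (h : I ^ r ≤ Ideal.span (Set.range fun i => x i - c i * y) * I ^ (r - 1)) :
    I ^ r ≤ Ideal.span (Set.range x) * I ^ (r - 1) := by
  have key : ∀ A : Finset ι,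
      IsPermutablyRegular I (fun i => x i - (if i ∈ A then c i else 0) * y) Finset.univ ∧
      (I ^ r ≤ Ideal.span (Set.range fun i => x i - (if i ∈ A then c i else 0) * y) *
          I ^ (r - 1) → I ^ r ≤ Ideal.span (Set.range x) * I ^ (r - 1)) := by
    intro A
    induction A using Finset.induction_on with
    | empty => simpa using hreg
    | insert b A hb ih =>
      have hw : ∀ (B : Finset ι) i, x i - (if i ∈ B then c i else 0) * y ∈ I := fun B i =>
        sub_mem (hx i) (Ideal.mul_mem_left _ _ hy)
      obtain ⟨h1, h2⟩ := ih.1.exchange hIm (hw A) (hw (insert b A)) (b := b)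
        (fun i hi => by simp [hi]) (hred A) (hred (insert b A))
      exact ⟨h1, fun h => ih.2 (h2 h)⟩
  refine (key Finset.univ).2 ?_
  simpa using h

theorem eval_aeval_self {S σ τ : Type*} [CommRing S] (v : τ → S) (g : σ → MvPolynomial τ S)
    (p : MvPolynomial σ S) : eval v (aeval g p) = eval (fun o => eval v (g o)) p := by
  induction p using MvPolynomial.induction_on with
  | C a => simp
  | add p q hp hq => rw [map_add, map_add, hp, hq, map_add]
  | mul_X p i hp => rw [map_mul, map_mul, hp, aeval_X, map_mul, eval_X]

theorem map_residue_eq_zero_of_eval_eq_zero [IsLocalRing R] [IsNoetherianRing R]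
    [Infinite (ResidueField R)] [Fintype ι] [DecidableEq ι] (hIm : I ≤ maximalIdeal R)
    (hz : ∀ o, z o ∈ I) (hI : Ideal.span (Set.range z) = I)
    (hreg : IsPermutablyRegular I (z ∘ some) Finset.univ) {r : ℕ}
    (hmin : ¬ I ^ r ≤ Ideal.span (Set.range (z ∘ some)) * I ^ (r - 1))
    {P : MvPolynomial (Option ι) R} (hP : P.IsHomogeneous (r + 1)) (hP0 : eval z P = 0)
    (hP1 : eval (fun o => o.elim 1 0) P = 1) {n : ℕ} (hn : n ≤ r)
    {p : MvPolynomial (Option ι) R} (hp : p.IsHomogeneous n) (hp0 : eval z p = 0) :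
    map (residue R) p = 0 := by
  by_contra hpne
  cases n with
  | zero =>
    have hpC := totalDegree_eq_zero_iff_eq_C.mp ((totalDegree_zero_iff_isHomogeneous _).mpr hp)
    rw [hpC, eval_C] at hp0
    rw [hpC, hp0] at hpne
    simp at hpne
  | succ n =>
    -- `q A` is P modulo 𝔪 with the variables Xᵢ, i ∉ A, set to zero. Its nonvanishing at a point
    -- ensures that the corresponding mixed family generates a reduction.
    let ρ : Finset ι → Option ι → MvPolynomial (Option ι) (ResidueField R) := fun A o =>
      o.elim (X none) fun i => if i ∈ A then X (some i) else 0
    let q : Finset ι → MvPolynomial (Option ι) (ResidueField R) := fun A =>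
      aeval (ρ A) (map (residue R) P)
    have hq : ∀ A, q A ≠ 0 := by
      intro A hA
      have h1 : eval (fun o => o.elim 1 0) (q A) = residue R (eval (fun o => o.elim 1 0) P) := by
        rw [eval_aeval_self, map_eval]
        congr 2
        funext o
        cases o with
        | none => simp [ρ]
        | some i => by_cases hi : i ∈ A <;> simp [ρ, hi]
      rw [hA, hP1] at h1
      simp at h1
    -- Over an infinite field one point avoids the zeros of finitely many nonzero polynomials. The
    -- factor Y allows the point to be scaled so that its last coordinate is 1.
    obtain ⟨v, hv⟩ : ∃ v : Option ι → ResidueField R,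
        eval v (map (residue R) p * X none * ∏ A : Finset ι, q A) ≠ 0 := by
      by_contra! hall
      have h0 : map (residue R) p * X none * ∏ A : Finset ι, q A = 0 :=
        MvPolynomial.funext fun v => by rw [hall v, map_zero]
      exact mul_ne_zero (mul_ne_zero hpne (X_ne_zero _))
        (Finset.prod_ne_zero_iff.mpr fun A _ => hq A) h0
    rw [map_mul, map_mul, eval_X, map_prod] at hv
    have hv0 : v none ≠ 0 := right_ne_zero_of_mul (left_ne_zero_of_mul hv)
    have hvp : eval v (map (residue R) p) ≠ 0 := left_ne_zero_of_mul (left_ne_zero_of_mul hv)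
    have hvq : ∀ A, eval v (q A) ≠ 0 := fun A =>
      Finset.prod_ne_zero_iff.mp (right_ne_zero_of_mul hv) A (Finset.mem_univ A)
    choose c hc using fun i => residue_surjective (R := R) (v (some i) / v none)
    have hunit : ∀ (A : Finset ι) (m : ℕ) (f : MvPolynomial (Option ι) R), f.IsHomogeneous m →
        eval (fun o => o.elim (v none) fun i => if i ∈ A then v (some i) else 0)
          (map (residue R) f) ≠ 0 →
        IsUnit (eval (fun o => o.elim 1 fun i => if i ∈ A then c i else 0) f) := by
      intro A m f hf hfv
      rw [← residue_ne_zero_iff_isUnit, map_eval]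
      have hpt : (residue R ∘ fun o : Option ι => o.elim 1 fun i => if i ∈ A then c i else 0) =
          fun o => (v none)⁻¹ * o.elim (v none) fun i => if i ∈ A then v (some i) else 0 := by
        funext o
        cases o with
        | none => simp [hv0]
        | some i =>
          by_cases hi : i ∈ A
          · simp [hi, hc, div_eq_inv_mul]
          · simp [hi]
      rw [hpt, eval_mul_of_isHomogeneous (hf.map _)]
      exact mul_ne_zero (pow_ne_zero _ (inv_ne_zero hv0)) hfv
    refine hmin (pow_le_span_mul_pow_pred_of_forall_reduction hIm (fun i => hz (some i))
      (hz none) hreg c ?_ ?_)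
    · intro A
      refine pow_succ_le_span_mul_pow_of_isUnit_eval hz hI hP hP0 (hunit A _ P hP ?_)
      have hρ : (fun o => eval v (ρ A o)) =
          fun o => o.elim (v none) fun i => if i ∈ A then v (some i) else 0 := by
        funext o
        cases o with
        | none => simp [ρ]
        | some i => by_cases hi : i ∈ A <;> simp [ρ, hi]
      have h := hvq A
      rwa [eval_aeval_self, hρ] at h
    -- As p does not vanish at the chosen point, the fully modified family reduces I in the degree
    -- of p, hence also in degree r.
    · have h1 := pow_succ_le_span_mul_pow_of_isUnit_eval hz hI hp hp0 (c := c) (by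
        simpa using hunit Finset.univ _ p hp (by
          convert hvp
          rename_i o
          cases o <;> simp))
      obtain ⟨k, rfl⟩ := Nat.exists_eq_add_of_le hn
      rw [pow_add, show n + 1 + k - 1 = n + k by omega, pow_add I n k, ← mul_assoc]
      exact Ideal.mul_mono_left h1

end GenericReduction

/-! ### Relation type -/

section RelationTypeLemmas

variable {A U σ : Type*} [CommRing A] [CommRing U] [Algebra A U] {z : σ → U}

theorem equationsUpTo_le_equations (n : ℕ) : equationsUpTo A z n ≤ equations A z :=
  Ideal.span_le.mpr fun _ hF => hF.1

theorem equationsUpTo_mono {m n : ℕ} (h : m ≤ n) : equationsUpTo A z m ≤ equationsUpTo A z n :=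
  Ideal.span_mono fun _ ⟨hF, d, hd, hFd⟩ => ⟨hF, d, hd.trans h, hFd⟩

theorem relationType_eq_succ {r : ℕ} (h : equations A z ≤ equationsUpTo A z (r + 1))
    {P : MvPolynomial σ A} (hP : P ∈ equations A z) (hP' : P ∉ equationsUpTo A z r) :
    relationType A z = r + 1 := by
  have hmem : r + 1 ∈ {N : ℕ | 1 ≤ N ∧ equations A z = equationsUpTo A z N} :=
    ⟨by omega, le_antisymm h (equationsUpTo_le_equations _)⟩
  refine le_antisymm (Nat.sInf_le hmem) ?_
  by_contra! hlt
  have hinf := Nat.sInf_mem ⟨_, hmem⟩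
  refine hP' (equationsUpTo_mono (Nat.lt_succ_iff.mp hlt) ?_)
  rw [relationType, ← hinf.2]
  exact hP

end RelationTypeLemmas

/-! ### Equations of the fiber cone -/

section FiberEquations

variable {R σ : Type*} [CommRing R] [IsLocalRing R] {I : Ideal R} {z : σ → R}

open _root_.MvPolynomial

theorem aeval_fiberGenerators_map (hz : ∀ i, z i ∈ I) (P : MvPolynomial σ R) :
    aeval (fiberGenerators I z hz) (map (residue R) P) =
      (1 : ResidueField R) ⊗ₜ[R] aeval (reesGenerators I z hz) P := by
  induction P using MvPolynomial.induction_on with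
  | C a =>
    rw [map_C, aeval_C, aeval_C, Algebra.TensorProduct.algebraMap_apply,
      Algebra.algebraMap_eq_smul_one (A := reesAlgebra I), ← TensorProduct.smul_tmul,
      Algebra.smul_def, mul_one]
    rfl
  | add p q hp hq => rw [map_add, map_add, map_add, hp, hq, TensorProduct.tmul_add]
  | mul_X p i hp =>
    rw [map_mul, map_mul, map_mul, hp, map_X, aeval_X, aeval_X, fiberGenerators,
      Algebra.TensorProduct.tmul_mul_tmul, mul_one]

theorem map_residue_mem_equations (hz : ∀ i, z i ∈ I) {P : MvPolynomial σ R}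
    (hP : P ∈ equations R (reesGenerators I z hz)) :
    map (residue R) P ∈ equations (ResidueField R) (fiberGenerators I z hz) := by
  rw [equations, RingHom.mem_ker] at hP ⊢
  exact (aeval_fiberGenerators_map hz P).trans (by rw [hP, TensorProduct.tmul_zero])

/-- Base change to the residue field is right exact: modulo the image `B` of the Rees equations, the
presentation factors through the tensor product by `ψ`, so its kernel is contained in `B`. -/
theorem exists_map_residue_eq_of_mem_equations (hz : ∀ i, z i ∈ I)
    (hI : Ideal.span (Set.range z) = I) {p : MvPolynomial σ (ResidueField R)}
    (hp : p ∈ equations (ResidueField R) (fiberGenerators I z hz)) :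
    ∃ P ∈ equations R (reesGenerators I z hz), map (residue R) P = p := by
  let B : Ideal (MvPolynomial σ (ResidueField R)) :=
    (equations R (reesGenerators I z hz)).map (map (residue R))
  let φ₀ : MvPolynomial σ R →ₐ[R] MvPolynomial σ (ResidueField R) ⧸ B :=
    (Ideal.Quotient.mkₐ R B).comp (mapAlgHom (Algebra.ofId R (ResidueField R)))
  have hφ₀ : ∀ P ∈ RingHom.ker (aeval (R := R) (reesGenerators I z hz)), φ₀ P = 0 :=
    fun P hP => Ideal.Quotient.eq_zero_iff_mem.mpr (Ideal.mem_map_of_mem (map (residue R)) hP)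
  let φ : reesAlgebra I →ₐ[R] MvPolynomial σ (ResidueField R) ⧸ B :=
    AlgHom.liftOfSurjective _ (aeval_reesGenerators_surjective hz hI) φ₀ hφ₀
  have hφ : ∀ P, φ (aeval (reesGenerators I z hz) P) = φ₀ P := fun P =>
    AlgHom.liftOfSurjective_apply _ _ _ _ P
  let ψ : FiberCone I →ₐ[ResidueField R] MvPolynomial σ (ResidueField R) ⧸ B :=
    Algebra.TensorProduct.lift (Algebra.ofId _ _) φ fun _ _ => Commute.all _ _
  have hψ : ψ.comp (aeval (fiberGenerators I z hz)) = Ideal.Quotient.mkₐ (ResidueField R) B := by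
    ext i
    have := hφ (X i)
    rw [aeval_X] at this
    simp [ψ, fiberGenerators, this, φ₀]
  have hpB : p ∈ B := by
    rw [← Ideal.Quotient.eq_zero_iff_mem]
    have h1 := DFunLike.congr_fun hψ p
    rw [AlgHom.comp_apply, show aeval (fiberGenerators I z hz) p = 0 from hp, map_zero] at h1
    exact h1.symm
  exact (Ideal.mem_map_iff_of_surjective _ (map_surjective _ residue_surjective)).mp hpB

theorem aeval_fiberGenerators_surjective (hz : ∀ i, z i ∈ I)
    (hI : Ideal.span (Set.range z) = I) :
    Function.Surjective (aeval (R := ResidueField R) (fiberGenerators I z hz)) := by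
  intro u
  change u ∈ (aeval (R := ResidueField R) (fiberGenerators I z hz)).range
  induction u using TensorProduct.induction_on with
  | zero => exact zero_mem _
  | add u v hu hv => exact add_mem hu hv
  | tmul a b =>
    obtain ⟨P, rfl⟩ := aeval_reesGenerators_surjective hz hI b
    refine ⟨a • map (residue R) P, ?_⟩
    change aeval (fiberGenerators I z hz) (a • map (residue R) P) = _
    rw [map_smul, aeval_fiberGenerators_map, TensorProduct.smul_tmul', smul_eq_mul, mul_one]

end FiberEquations

/-! ### Nakayama's lemma and minimal generators -/

section Minimality

variable {R σ : Type*} [CommRing R] [IsLocalRing R] [IsNoetherianRing R] {I : Ideal R}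

theorem IsMinimalGeneratingFamily.notMem_maximalIdeal_mul {z : σ → R}
    (h : IsMinimalGeneratingFamily I z) (i : σ) : z i ∉ maximalIdeal R * I := by
  intro hi
  refine h.not_mem_span i ?_
  have hle : I ≤ Ideal.span (z '' {j | j ≠ i}) := by
    refine Submodule.le_of_le_smul_of_le_jacobson_bot (IsNoetherian.noetherian I)
      (IsLocalRing.maximalIdeal_le_jacobson ⊥) ?_
    conv_lhs => rw [← h.span_eq]
    rw [Ideal.span_le]
    rintro _ ⟨j, rfl⟩
    by_cases hj : j = i
    · subst hj; exact Ideal.mem_sup_right hi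
    · exact Ideal.mem_sup_left (Ideal.subset_span ⟨j, hj, rfl⟩)
  exact hle (h.mem i)

end Minimality

/-! ### Both relation types and the single fiber equation -/

section DeviationOne

open _root_.MvPolynomial

variable {R ι : Type*} [CommRing R] {I : Ideal R} {z : Option ι → R} {r : ℕ}
  {F : ι → MvPolynomial (Option ι) R}

theorem equationsUpTo_le_ker_map_residue [IsLocalRing R]
    (hz : ∀ o, z o ∈ I)
    (hlow : ∀ d ≤ r, ∀ p : MvPolynomial (Option ι) R, p.IsHomogeneous d → eval z p = 0 →
      map (residue R) p = 0) :
    equationsUpTo R (reesGenerators I z hz) r ≤ RingHom.ker (map (σ := Option ι) (residue R)) := by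
  refine Ideal.span_le.mpr ?_
  rintro p ⟨hp, d, hd, hpd⟩
  exact hlow d hd p hpd ((mem_equations_reesGenerators_iff_of_isHomogeneous hz hpd).mp hp)

theorem equationsUpTo_fiberGenerators_eq_bot [IsLocalRing R]
    (hz : ∀ o, z o ∈ I)
    (hI : Ideal.span (Set.range z) = I)
    (hlow : ∀ d ≤ r, ∀ p : MvPolynomial (Option ι) R, p.IsHomogeneous d → eval z p = 0 →
      map (residue R) p = 0) :
    equationsUpTo (ResidueField R) (fiberGenerators I z hz) r = ⊥ := by
  rw [eq_bot_iff, equationsUpTo, Ideal.span_le]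
  rintro p ⟨hp, d, hd, hpd⟩
  obtain ⟨P, hP, rfl⟩ := exists_map_residue_eq_of_mem_equations hz hI hp
  have h0 := hlow d hd _ (homogeneousComponent_isHomogeneous d P)
    ((mem_equations_reesGenerators_iff hz).mp hP d)
  have h1 : map (residue R) (homogeneousComponent d P) =
      homogeneousComponent d (map (residue R) P) := by
    ext m
    simp only [coeff_map, coeff_homogeneousComponent]
    split_ifs <;> simp
  rw [h1, homogeneousComponent_eq_self hpd] at h0
  exact h0

theorem equations_reesGenerators_le [Fintype ι] [DecidableEq ι] (hz : ∀ o, z o ∈ I)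
    (hI : Ideal.span (Set.range z) = I)
    (hreg : IsPermutablyRegular I (z ∘ some) Finset.univ) (hr : 0 < r)
    (hF : ∀ i, (F i).IsHomogeneous r)
    (hF0 : eval z (X none ^ (r + 1) - ∑ i, X (some i) * F i) = 0) :
    equations R (reesGenerators I z hz) ≤
      Ideal.span {X none ^ (r + 1) - ∑ i, X (some i) * F i} ⊔
        equationsUpTo R (reesGenerators I z hz) r := by
  intro p hp
  rw [← sum_homogeneousComponent p]
  exact Ideal.sum_mem _ fun n _ => mem_span_sup_equationsUpTo hz hI hreg hr hF hF0
    (homogeneousComponent_isHomogeneous n p) ((mem_equations_reesGenerators_iff hz).mp hp n)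

variable [Fintype ι] [IsLocalRing R]

theorem isHomogeneous_X_none_pow_sub_sum {S : Type*} [CommRing S]
    {F : ι → MvPolynomial (Option ι) S} (hF : ∀ i, (F i).IsHomogeneous r) :
    (X none ^ (r + 1) - ∑ i, X (some i) * F i).IsHomogeneous (r + 1) :=
  (isHomogeneous_X_pow _ _).sub (IsHomogeneous.sum _ _ _ fun i _ => by
    rw [add_comm]; exact (isHomogeneous_X S _).mul (hF i))

theorem eval_X_none_pow_sub_sum {S : Type*} [CommRing S] (F : ι → MvPolynomial (Option ι) S) :
    eval (fun o => o.elim 1 0) (X none ^ (r + 1) - ∑ i, X (some i) * F i) = 1 := by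
  simp [map_sub, map_sum]

theorem map_residue_X_none_pow_sub_sum (F : ι → MvPolynomial (Option ι) R) :
    map (residue R) (X none ^ (r + 1) - ∑ i, X (some i) * F i) =
      X none ^ (r + 1) - ∑ i, X (some i) * map (residue R) (F i) := by
  simp [map_sub, map_sum]

theorem X_none_pow_sub_sum_ne_zero {S : Type*} [CommRing S] [Nontrivial S]
    (F : ι → MvPolynomial (Option ι) S) :
    X none ^ (r + 1) - ∑ i, X (some i) * F i ≠ 0 := fun h => by
  have := eval_X_none_pow_sub_sum (r := r) F
  rw [h, map_zero] at this
  exact zero_ne_one this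

variable (hz : ∀ o, z o ∈ I)

theorem relationType_reesGenerators_eq [DecidableEq ι]
    (hI : Ideal.span (Set.range z) = I)
    (hreg : IsPermutablyRegular I (z ∘ some) Finset.univ) (hr : 0 < r)
    (hF : ∀ i, (F i).IsHomogeneous r)
    (hF0 : eval z (X none ^ (r + 1) - ∑ i, X (some i) * F i) = 0)
    (hlow : ∀ d ≤ r, ∀ p : MvPolynomial (Option ι) R, p.IsHomogeneous d → eval z p = 0 →
      map (residue R) p = 0) :
    relationType R (reesGenerators I z hz) = r + 1 := by
  have hP := (mem_equations_reesGenerators_iff_of_isHomogeneous hz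
    (isHomogeneous_X_none_pow_sub_sum hF)).mpr hF0
  refine relationType_eq_succ ((equations_reesGenerators_le hz hI hreg hr hF hF0).trans
    (sup_le ?_ (equationsUpTo_mono (Nat.le_succ r)))) hP fun h => ?_
  · rw [Ideal.span_singleton_le_iff_mem]
    exact Ideal.subset_span ⟨hP, r + 1, le_rfl, isHomogeneous_X_none_pow_sub_sum hF⟩
  · have h0 := equationsUpTo_le_ker_map_residue hz hlow h
    rw [RingHom.mem_ker, map_residue_X_none_pow_sub_sum] at h0
    exact X_none_pow_sub_sum_ne_zero _ h0

theorem equations_fiberGenerators_eq [DecidableEq ι]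
    (hI : Ideal.span (Set.range z) = I)
    (hreg : IsPermutablyRegular I (z ∘ some) Finset.univ) (hr : 0 < r)
    (hF : ∀ i, (F i).IsHomogeneous r)
    (hF0 : eval z (X none ^ (r + 1) - ∑ i, X (some i) * F i) = 0)
    (hlow : ∀ d ≤ r, ∀ p : MvPolynomial (Option ι) R, p.IsHomogeneous d → eval z p = 0 →
      map (residue R) p = 0) :
    equations (ResidueField R) (fiberGenerators I z hz) =
      Ideal.span {X none ^ (r + 1) - ∑ i, X (some i) * map (residue R) (F i)} := by
  apply le_antisymm
  · intro p hp
    obtain ⟨P, hP, rfl⟩ := exists_map_residue_eq_of_mem_equations hz hI hp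
    obtain ⟨a, ha, b, hb, rfl⟩ :=
      Submodule.mem_sup.mp (equations_reesGenerators_le hz hI hreg hr hF hF0 hP)
    have hb0 : map (residue R) b = 0 := equationsUpTo_le_ker_map_residue hz hlow hb
    rw [map_add, hb0, add_zero, ← map_residue_X_none_pow_sub_sum]
    obtain ⟨c, rfl⟩ := Ideal.mem_span_singleton'.mp ha
    rw [map_mul]
    exact Ideal.mul_mem_left _ _ (Ideal.mem_span_singleton_self _)
  · rw [Ideal.span_singleton_le_iff_mem, ← map_residue_X_none_pow_sub_sum]
    exact map_residue_mem_equations hz ((mem_equations_reesGenerators_iff_of_isHomogeneous hz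
      (isHomogeneous_X_none_pow_sub_sum hF)).mpr hF0)

theorem relationType_fiberGenerators_eq [DecidableEq ι]
    (hI : Ideal.span (Set.range z) = I)
    (hreg : IsPermutablyRegular I (z ∘ some) Finset.univ) (hr : 0 < r)
    (hF : ∀ i, (F i).IsHomogeneous r)
    (hF0 : eval z (X none ^ (r + 1) - ∑ i, X (some i) * F i) = 0)
    (hlow : ∀ d ≤ r, ∀ p : MvPolynomial (Option ι) R, p.IsHomogeneous d → eval z p = 0 →
      map (residue R) p = 0) :
    relationType (ResidueField R) (fiberGenerators I z hz) = r + 1 := by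
  have heq := equations_fiberGenerators_eq hz hI hreg hr hF hF0 hlow
  have hP : X none ^ (r + 1) - ∑ i, X (some i) * map (residue R) (F i) ∈
      equations (ResidueField R) (fiberGenerators I z hz) := by
    rw [heq]; exact Ideal.mem_span_singleton_self _
  refine relationType_eq_succ ?_ hP fun h => ?_
  · conv_lhs => rw [heq]
    rw [Ideal.span_singleton_le_iff_mem]
    exact Ideal.subset_span
      ⟨hP, r + 1, le_rfl, isHomogeneous_X_none_pow_sub_sum fun i => (hF i).map _⟩
  · rw [equationsUpTo_fiberGenerators_eq_bot hz hI hlow] at h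
    exact X_none_pow_sub_sum_ne_zero _ h

end DeviationOne

/-! ### Minimality of the reduction number -/

section ReductionNumber

variable {R : Type*} [CommRing R] {I J : Ideal R}

theorem IsReduction.pow_reductionNumber_succ (h : IsReduction J I) :
    I ^ (reductionNumber J I + 1) = J * I ^ reductionNumber J I :=
  Nat.sInf_mem h.2

theorem IsReduction.not_pow_le_mul_pow_pred (h : IsReduction J I) {r : ℕ}
    (hr : r = reductionNumber J I) (hr0 : 0 < r) : ¬ I ^ r ≤ J * I ^ (r - 1) := by
  intro hle
  obtain ⟨n, rfl⟩ : ∃ n, r = n + 1 := ⟨r - 1, by omega⟩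
  have hmem : n ∈ {n : ℕ | I ^ (n + 1) = J * I ^ n} := by
    refine le_antisymm hle ?_
    rw [pow_succ']
    exact Ideal.mul_mono_left h.1
  have := Nat.sInf_le hmem
  rw [reductionNumber] at hr
  omega

end ReductionNumber

end BlowupAlgebra

/-! ### The theorem -/

theorem mainTheorem3 {R : Type*} [CommRing R] [IsLocalRing R] [IsNoetherianRing R]
    [Infinite (IsLocalRing.ResidueField R)]
    (I J : Ideal R) {s : ℕ} (x : Fin s → R) (y : R)
    (hI : BlowupAlgebra.IsMinimalGeneratingFamily I (BlowupAlgebra.adjoinElt x y))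
    (hJ : J = Ideal.span (Set.range x))
    (hred : BlowupAlgebra.IsReduction J I)
    (r : ℕ) (hr : r = BlowupAlgebra.reductionNumber J I)
    (hreg : RingTheory.Sequence.IsRegular R (List.ofFn x))
    (hG : RingTheory.Sequence.IsRegular (BlowupAlgebra.AssociatedGraded I)
      ((List.ofFn x).dropLast.map (BlowupAlgebra.initialForm I))) :
    (∃ F : Fin s → MvPolynomial (Option (Fin s)) (IsLocalRing.ResidueField R),
      (∀ i, (F i).IsHomogeneous r) ∧
      ∃ e : (MvPolynomial (Option (Fin s)) (IsLocalRing.ResidueField R) ⧸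
            Ideal.span {MvPolynomial.X (none : Option (Fin s)) ^ (r + 1) -
              ∑ i, MvPolynomial.X (some i) * F i})
          ≃ₐ[IsLocalRing.ResidueField R] BlowupAlgebra.FiberCone I,
        ∀ o : Option (Fin s), e (Ideal.Quotient.mk _ (MvPolynomial.X o)) =
          BlowupAlgebra.fiberGenerators I (BlowupAlgebra.adjoinElt x y) hI.mem o) ∧
    BlowupAlgebra.relationType (IsLocalRing.ResidueField R)
      (BlowupAlgebra.fiberGenerators I (BlowupAlgebra.adjoinElt x y) hI.mem) = r + 1 ∧
    BlowupAlgebra.relationType R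
      (BlowupAlgebra.reesGenerators I (BlowupAlgebra.adjoinElt x y) hI.mem) = r + 1 := by
  open BlowupAlgebra in
  have hx : ∀ i, x i ∈ I := fun i => hI.mem (some i)
  have hpow : I ^ (r + 1) = J * I ^ r := hr ▸ hred.pow_reductionNumber_succ
  -- If I were R, the reduction equation would give J = R, but a regular sequence generates a proper
  -- ideal.
  have hIm : I ≤ IsLocalRing.maximalIdeal R := by
    refine IsLocalRing.le_maximalIdeal fun htop => hreg.top_ne_smul ?_
    rw [htop, Ideal.top_pow, Ideal.top_pow, Ideal.mul_top] at hpow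
    have h := ofList_take_ofFn x s
    rw [List.take_of_length_le (by simp)] at h
    simpa [h, ← Set.image_univ, hJ] using hpow
  have hx2 : ∀ i, x i ∉ I ^ 2 := fun i hi => by
    rw [pow_two] at hi
    exact hI.notMem_maximalIdeal_mul (some i) (Ideal.mul_mono_left hIm hi)
  -- Reduction number zero would mean I = J, making y redundant.
  have hr0 : 0 < r := by
    rw [Nat.pos_iff_ne_zero]
    rintro rfl
    refine hI.not_mem_span none ?_
    have h1 : adjoinElt x y none ∈ J := by
      have := hI.mem none
      rw [zero_add, pow_one, pow_zero, Ideal.one_eq_top, Ideal.mul_top] at hpow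
      rwa [← hpow]
    rw [hJ] at h1
    refine Ideal.span_mono ?_ h1
    rintro _ ⟨i, rfl⟩
    exact ⟨some i, by simp, rfl⟩
  have hperm : IsPermutablyRegular I x Finset.univ :=
    isPermutablyRegular_of_initialForms_isWeaklyRegular hIm hx hx2 hreg.toIsWeaklyRegular
      hG.toIsWeaklyRegular
  have hmin := hred.not_pow_le_mul_pow_pred hr hr0
  obtain ⟨u, hu, hyu⟩ : ∃ u : Fin s → R, (∀ i, u i ∈ I ^ r) ∧ y ^ (r + 1) = ∑ i, x i * u i := by
    refine exists_sum_of_mem_span_image_mul ?_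
    rw [Finset.coe_univ, Set.image_univ, ← hJ, ← hpow]
    exact Ideal.pow_mem_pow (hI.mem none) _
  choose F hF hFu using fun i => exists_isHomogeneous_of_mem_pow hI.span_eq (hu i)
  have hF0 : MvPolynomial.eval (adjoinElt x y)
      (MvPolynomial.X none ^ (r + 1) - ∑ i, MvPolynomial.X (some i) * F i) = 0 := by
    simp only [map_sub, map_pow, map_sum, map_mul, MvPolynomial.eval_X, hFu]
    exact sub_eq_zero.mpr hyu
  have hlow : ∀ d ≤ r, ∀ p : MvPolynomial (Option (Fin s)) R, p.IsHomogeneous d →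
      MvPolynomial.eval (adjoinElt x y) p = 0 →
      MvPolynomial.map (IsLocalRing.residue R) p = 0 := fun d hd p hp hp0 =>
    map_residue_eq_zero_of_eval_eq_zero hIm hI.mem hI.span_eq hperm (hJ ▸ hmin)
      (isHomogeneous_X_none_pow_sub_sum hF) hF0 (eval_X_none_pow_sub_sum F) hd hp hp0
  refine ⟨⟨fun i => MvPolynomial.map (IsLocalRing.residue R) (F i), fun i => (hF i).map _, ?_⟩,
    relationType_fiberGenerators_eq hI.mem hI.span_eq hperm hr0 hF hF0 hlow,
    relationType_reesGenerators_eq hI.mem hI.span_eq hperm hr0 hF hF0 hlow⟩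
  refine ⟨(Ideal.quotientEquivAlgOfEq _ (equations_fiberGenerators_eq hI.mem hI.span_eq hperm
    hr0 hF hF0 hlow).symm).trans (Ideal.quotientKerAlgEquivOfSurjective
      (aeval_fiberGenerators_surjective hI.mem hI.span_eq)), fun o => ?_⟩
  exact MvPolynomial.aeval_X _ o
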